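/- Consider games with $n$ players, each having the two actions $0,1$, given by utility functions $u_1,\dots,u_n:\{0,1\}^n\to\mathbb{R}$. Such a game is a potential game if there is a function $\phi:\{0,1\}^n\to\mathbb{R}$ such that $u_i(x_i,z_{-i})-u_i(y_i,z_{-i})=\phi(x_i,z_{-i})-\phi(y_i,z_{-i})$ for every player $i$, all actions $x_i,y_i$ of $i$ and all actions $z_{-i}$ of the other players. A query algorithm does not know the utilities; it adaptively queries pure action profiles $a\in\{0,1\}^n$, receives the vector $(u_1(a),\dots,u_n(a))$ as the answer to each query, and finally outputs a profile of mixed strategies. Let $QC(n)$ be the least $q$ for which there is a randomized query algorithm that makes at most $q$ queries on every $n$-player binary-action potential game and, on every such game, outputs a (possibly mixed) Nash equilibrium with probability at least $2/3$. Then $QC(n)\ge 2^{\Omega(\sqrt n)}$; that is, there are constants $c>0$ and $N$ such that $QC(n)\ge 2^{c\sqrt n}$ for every $n\ge N$. -/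

import Mathlib

namespace PotentialQuery

/-- A pure action profile of `n` players with the two actions `false`, `true`. -/
abbrev Profile (n : ℕ) : Type := Fin n → Bool

/-- An `n`-player binary-action game in normal form: `u i a` is the utility of player `i`
when the pure profile `a` is played. -/
abbrev Game (n : ℕ) : Type := Fin n → Profile n → ℝ

/-- A game is a potential game if some function `φ` on pure profiles changes, under every
unilateral change of action, by exactly the change of the deviator's utility. -/
def IsPotentialGame {n : ℕ} (u : Game n) : Prop :=
  ∃ φ : Profile n → ℝ, ∀ (i : Fin n) (x y : Bool) (z : Profile n),
    u i (Function.update z i x) - u i (Function.update z i y)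
      = φ (Function.update z i x) - φ (Function.update z i y)

/-- A mixed profile: each player independently plays a probability vector on the two actions. -/
abbrev MixedProfile (n : ℕ) : Type := Fin n → stdSimplex ℝ Bool

/-- The expected utility of player `i` under a mixed profile. -/
noncomputable def expectedUtility {n : ℕ} (u : Game n) (σ : MixedProfile n) (i : Fin n) : ℝ :=
  ∑ a : Profile n, (∏ j : Fin n, (σ j : Bool → ℝ) (a j)) * u i a

/-- A (possibly mixed) Nash equilibrium: no player gains by a unilateral change of strategy. -/
def IsNash {n : ℕ} (u : Game n) (σ : MixedProfile n) : Prop :=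
  ∀ (i : Fin n) (τ : stdSimplex ℝ Bool),
    expectedUtility u (Function.update σ i τ) i ≤ expectedUtility u σ i

/-- A deterministic adaptive query algorithm, as a decision tree. It either stops and outputs a
mixed profile, or queries a pure profile and continues depending on the answer, which is the
vector of the utilities of all players at that profile. There is no restriction on computation. -/
inductive Algorithm (n : ℕ) : Type
  | output (σ : MixedProfile n) : Algorithm n
  | query (a : Profile n) (next : (Fin n → ℝ) → Algorithm n) : Algorithm n

namespace Algorithm

/-- The mixed profile that the algorithm outputs on the game `u`. -/
def run {n : ℕ} (u : Game n) : Algorithm n → MixedProfile n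
  | output σ => σ
  | query a next => run u (next fun i => u i a)

/-- The number of queries that the algorithm makes on the game `u`. -/
def numQueries {n : ℕ} (u : Game n) : Algorithm n → ℕ
  | output _ => 0
  | query a next => numQueries u (next fun i => u i a) + 1

end Algorithm

/-- A randomized query algorithm: a deterministic one that depends on a random seed `ω`. -/
structure RandomizedAlgorithm (n : ℕ) where
  Ω : Type
  [measurableSpace : MeasurableSpace Ω]
  μ : MeasureTheory.Measure Ω
  [isProbabilityMeasure : MeasureTheory.IsProbabilityMeasure μ]
  alg : Ω → Algorithm n

attribute [instance] RandomizedAlgorithm.measurableSpace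
  RandomizedAlgorithm.isProbabilityMeasure

/-- On every potential game the algorithm makes at most `q` queries, whatever the seed. -/
def RandomizedAlgorithm.QueriesAtMost {n : ℕ} (A : RandomizedAlgorithm n) (q : ℕ) : Prop :=
  ∀ u : Game n, IsPotentialGame u → ∀ ω : A.Ω, (A.alg ω).numQueries u ≤ q

/-- On every potential game the algorithm outputs a Nash equilibrium with probability at
least `2/3`. (The event of success need not be measurable; it has to contain a measurable
event of probability at least `2/3`.) -/
def RandomizedAlgorithm.FindsNash {n : ℕ} (A : RandomizedAlgorithm n) : Prop :=
  ∀ u : Game n, IsPotentialGame u →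
    ∃ S : Set A.Ω, MeasurableSet S ∧ 2 / 3 ≤ A.μ S ∧ ∀ ω ∈ S, IsNash u ((A.alg ω).run u)

/-- The (randomized, bounded-error, worst-case) query complexity of finding a Nash equilibrium
in `n`-player binary-action potential games. -/
noncomputable def queryComplexity (n : ℕ) : ℕ∞ :=
  ⨅ (q : ℕ) (_ : ∃ A : RandomizedAlgorithm n, A.QueriesAtMost q ∧ A.FindsNash), (q : ℕ∞)

end PotentialQuery

/-! Already games with a common utility are hard, and the bound obtained is `2^(n/8)`. A path
through independent uniform waypoints is hidden in the cube. The utility grows by a factor of at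
least `2^(n+1)` from each vertex to some neighbour, except at the end of the path. This factor
outweighs the number of profiles, so even a mixed equilibrium must give the end positive weight
(`weight_pos_of_isNash`). If some player mixes, indifference fixes the utility at the end once all
other values are known (`apply_eq_of_isNash_of_isNash`). So an algorithm that is right for both of
two possible values there must query the end or output it as a pure profile; one additional query
covers the second case (`not_isNash_and_isNash`).

Reaching the end is expensive: given the path up to a waypoint, each vertex from the next waypoint
on is still uniform among `2^n` profiles (`card_path_mem_mul_le`). Apart from rare lucky guesses,
each query therefore passes at most one new waypoint (`getElem?_queries_ne_path`), and an end `m`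
waypoints away is missed by `m` queries. Averaging over the hard games then gives success
probability below `2/3`. -/

namespace PotentialQuery

open Finset

/-! ### Mixed equilibria of common-utility games. -/

section Equilibria

variable {n : ℕ}

/-- The probability of the pure profile `a` under the mixed profile `σ`. -/
noncomputable def weight (σ : MixedProfile n) (a : Profile n) : ℝ :=
  ∏ j : Fin n, (σ j : Bool → ℝ) (a j)

/-- The degenerate strategy that plays `b`. -/
noncomputable def pureStrategy (b : Bool) : stdSimplex ℝ Bool :=
  ⟨Pi.single b 1, single_mem_stdSimplex ℝ b⟩

/-- The game in which all players have the utility `φ`. -/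
def commonGame (φ : Profile n → ℝ) : Game n := fun _ => φ

theorem isPotentialGame_commonGame (φ : Profile n → ℝ) : IsPotentialGame (commonGame φ) :=
  ⟨φ, fun _ _ _ _ => rfl⟩

theorem strategy_nonneg (s : stdSimplex ℝ Bool) (b : Bool) : 0 ≤ (s : Bool → ℝ) b := s.2.1 b

theorem strategy_sum (s : stdSimplex ℝ Bool) :
    (s : Bool → ℝ) true + (s : Bool → ℝ) false = 1 :=
  (Fintype.sum_bool _).symm.trans s.2.2

theorem strategy_le_one (s : stdSimplex ℝ Bool) (b : Bool) : (s : Bool → ℝ) b ≤ 1 := by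
  have h := strategy_sum s
  have h1 := strategy_nonneg s true
  have h2 := strategy_nonneg s false
  cases b <;> linarith

theorem weight_nonneg (σ : MixedProfile n) (a : Profile n) : 0 ≤ weight σ a :=
  prod_nonneg fun j _ => strategy_nonneg (σ j) (a j)

theorem weight_eq_mul (σ : MixedProfile n) (a : Profile n) (i : Fin n) :
    weight σ a = (σ i : Bool → ℝ) (a i) * ∏ j ∈ univ.erase i, (σ j : Bool → ℝ) (a j) :=
  (mul_prod_erase univ (fun j => (σ j : Bool → ℝ) (a j)) (mem_univ i)).symm

theorem weight_update (σ : MixedProfile n) (a : Profile n) (i : Fin n) (s : stdSimplex ℝ Bool) :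
    weight (Function.update σ i s) a
      = (s : Bool → ℝ) (a i) * ∏ j ∈ univ.erase i, (σ j : Bool → ℝ) (a j) := by
  rw [weight_eq_mul _ a i, Function.update_self]
  congr 1
  refine prod_congr rfl fun j hj => ?_
  rw [Function.update_of_ne (ne_of_mem_erase hj)]

theorem weight_le_weight_update (σ : MixedProfile n) (a : Profile n) (i : Fin n) (b : Bool) :
    weight σ a ≤ weight (Function.update σ i (pureStrategy b)) (Function.update a i b) := by
  rw [weight_update, weight_eq_mul σ a i]
  have h : ∏ j ∈ univ.erase i, (σ j : Bool → ℝ) (Function.update a i b j)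
      = ∏ j ∈ univ.erase i, (σ j : Bool → ℝ) (a j) :=
    prod_congr rfl fun j hj => by rw [Function.update_of_ne (ne_of_mem_erase hj)]
  rw [h]
  refine mul_le_mul_of_nonneg_right ?_ (prod_nonneg fun j _ => strategy_nonneg _ _)
  simp [pureStrategy]

theorem expectedUtility_commonGame (φ : Profile n → ℝ) (σ : MixedProfile n) (i : Fin n) :
    expectedUtility (commonGame φ) σ i = ∑ a, weight σ a * φ a := rfl

theorem sum_weight_eq_add (φ : Profile n → ℝ) (σ : MixedProfile n) (i : Fin n) :
    ∑ a, weight σ a * φ a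
      = (σ i : Bool → ℝ) true * ∑ a, weight (Function.update σ i (pureStrategy true)) a * φ a
        + (σ i : Bool → ℝ) false *
          ∑ a, weight (Function.update σ i (pureStrategy false)) a * φ a := by
  rw [mul_sum, mul_sum, ← sum_add_distrib]
  refine sum_congr rfl fun a _ => ?_
  rw [weight_update, weight_update, weight_eq_mul σ a i]
  cases h : a i <;> simp [pureStrategy] <;> ring

/-- If every profile other than `x` has a neighbour whose value is larger by a factor above the
number of profiles, then every equilibrium gives `x` positive probability. -/
theorem weight_pos_of_isNash {φ : Profile n → ℝ} {x : Profile n} (hφ : ∀ a, 0 < φ a)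
    (hx : ∀ a, a ≠ x → ∃ i b, (2 : ℝ) ^ (n + 1) * φ a ≤ φ (Function.update a i b))
    {σ : MixedProfile n} (hσ : IsNash (commonGame φ) σ) : 0 < weight σ x := by
  -- The profile `a` contributes most to the expected utility, which is thus at most `2^n` times its
  -- term. If `a ≠ x`, deviating towards its better neighbour yields at least `2^(n+1)` times that
  -- term.
  obtain ⟨a, -, ha⟩ := exists_max_image (univ : Finset (Profile n)) (fun a => weight σ a * φ a)
    ⟨fun _ => false, mem_univ _⟩
  have htot : ∑ a, weight σ a = 1 := by
    have h := prod_univ_sum (fun _ : Fin n => (univ : Finset Bool))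
      (fun j b => (σ j : Bool → ℝ) b)
    simp only [Fintype.piFinset_univ] at h
    have h1 : ∏ j : Fin n, ∑ b, (σ j : Bool → ℝ) b = 1 :=
      prod_eq_one fun j _ => (σ j).2.2
    rw [h1] at h
    exact h.symm
  have hpos : 0 < weight σ a * φ a := by
    by_contra hle
    have hz : ∀ b, weight σ b = 0 := fun b => by
      have h1 := (ha b (mem_univ b)).trans (not_lt.mp hle)
      have h2 := weight_nonneg σ b
      nlinarith [hφ b]
    simp [hz] at htot
  have hwa : 0 < weight σ a := pos_of_mul_pos_left hpos (hφ a).le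
  by_cases hax : a = x
  · exact hax ▸ hwa
  exfalso
  obtain ⟨i, b, hib⟩ := hx a hax
  have hdev := hσ i (pureStrategy b)
  rw [expectedUtility_commonGame, expectedUtility_commonGame] at hdev
  have hup : ∑ c, weight σ c * φ c ≤ 2 ^ n * (weight σ a * φ a) := by
    refine (sum_le_card_nsmul univ _ _ fun c hc => ha c hc).trans (le_of_eq ?_)
    simp
  have hlow := single_le_sum
    (f := fun c => weight (Function.update σ i (pureStrategy b)) c * φ c)
    (fun c _ => mul_nonneg (weight_nonneg _ c) (hφ c).le) (mem_univ (Function.update a i b))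
  have h1 : weight σ a * (2 ^ (n + 1) * φ a)
      ≤ weight (Function.update σ i (pureStrategy b)) (Function.update a i b)
        * φ (Function.update a i b) :=
    mul_le_mul (weight_le_weight_update σ a i b) hib
      (mul_nonneg (by positivity) (hφ a).le) (weight_nonneg _ _)
  have h2 : (2 : ℝ) ^ (n + 1) * (weight σ a * φ a) ≤ 2 ^ n * (weight σ a * φ a) := by
    linarith
  rw [pow_succ] at h2
  have h3 : 0 < (2 : ℝ) ^ n * (weight σ a * φ a) := by positivity
  linarith

/-- A player who mixes in an equilibrium is indifferent between the two actions. -/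
theorem sum_weight_update_eq_of_isNash {φ : Profile n → ℝ} {σ : MixedProfile n}
    (hσ : IsNash (commonGame φ) σ) {i : Fin n} (ht : 0 < (σ i : Bool → ℝ) true)
    (hf : 0 < (σ i : Bool → ℝ) false) (b c : Bool) :
    ∑ a, weight (Function.update σ i (pureStrategy b)) a * φ a
      = ∑ a, weight (Function.update σ i (pureStrategy c)) a * φ a := by
  have h1 := hσ i (pureStrategy true)
  have h2 := hσ i (pureStrategy false)
  rw [expectedUtility_commonGame, expectedUtility_commonGame] at h1 h2
  have h3 := sum_weight_eq_add φ σ i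
  have h4 := strategy_sum (σ i)
  set s := ∑ a, weight σ a * φ a
  set t := ∑ a, weight (Function.update σ i (pureStrategy true)) a * φ a with hst
  set f := ∑ a, weight (Function.update σ i (pureStrategy false)) a * φ a with hsf
  have key : t = f := by
    have h5 : (σ i : Bool → ℝ) true * (s - t) + (σ i : Bool → ℝ) false * (s - f) = 0 := by
      linear_combination h3 + s * h4
    have h6 := mul_nonneg ht.le (sub_nonneg.mpr h1)
    have h7 := mul_nonneg hf.le (sub_nonneg.mpr h2)
    have h8 : (σ i : Bool → ℝ) true * (s - t) = 0 := by linarith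
    have h9 : (σ i : Bool → ℝ) false * (s - f) = 0 := by linarith
    have := (mul_eq_zero.mp h8).resolve_left ht.ne'
    have := (mul_eq_zero.mp h9).resolve_left hf.ne'
    linarith
  cases b <;> cases c <;> simp only [← hst, ← hsf, key]

/-- A mixed equilibrium whose support contains `x` is not an equilibrium any more when the
common utility of `x` alone is changed. -/
theorem apply_eq_of_isNash_of_isNash {φ ψ : Profile n → ℝ} {x : Profile n}
    (hφψ : ∀ a, a ≠ x → φ a = ψ a) {σ : MixedProfile n} (hφ : IsNash (commonGame φ) σ)
    (hψ : IsNash (commonGame ψ) σ) (hx : 0 < weight σ x) {i : Fin n}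
    (ht : 0 < (σ i : Bool → ℝ) true) (hf : 0 < (σ i : Bool → ℝ) false) : φ x = ψ x := by
  have h1 := sum_weight_update_eq_of_isNash hφ ht hf (x i) (!x i)
  have h2 := sum_weight_update_eq_of_isNash hψ ht hf (x i) (!x i)
  have diff : ∀ τ : MixedProfile n, ∑ a, weight τ a * φ a - ∑ a, weight τ a * ψ a
      = weight τ x * (φ x - ψ x) := fun τ => by
    rw [← sum_sub_distrib, sum_eq_single x]
    · ring
    · intro a _ ha
      rw [hφψ a ha, sub_self]
    · simp
  -- The value at `x` enters the payoff of the action `x i` with positive weight and that of the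
  -- opposite action not at all, so at most one value makes player `i` indifferent.
  have h3 := diff (Function.update σ i (pureStrategy (x i)))
  have h4 := diff (Function.update σ i (pureStrategy (!x i)))
  have h5 : weight (Function.update σ i (pureStrategy (!x i))) x = 0 := by
    rw [weight_update]
    simp [pureStrategy]
  have h6 := hx.trans_le (weight_le_weight_update σ x i (x i))
  rw [Function.update_eq_self] at h6
  rw [h5, zero_mul] at h4
  have h7 : weight (Function.update σ i (pureStrategy (x i))) x * (φ x - ψ x) = 0 := by linarith
  linarith [(mul_eq_zero.mp h7).resolve_left h6.ne']

/-- The pure profile to which a mixed profile is rounded. -/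
noncomputable def rounding (σ : MixedProfile n) : Profile n :=
  open Classical in fun i => decide ((σ i : Bool → ℝ) true = 1)

/-- If nobody mixes, the only profile of positive weight is the rounding. -/
theorem exists_mixing_of_rounding_ne {σ : MixedProfile n} {x : Profile n}
    (hx : 0 < weight σ x) (hne : rounding σ ≠ x) :
    ∃ i, 0 < (σ i : Bool → ℝ) true ∧ 0 < (σ i : Bool → ℝ) false := by
  obtain ⟨i, hi⟩ := Function.ne_iff.mp hne
  have hxi : 0 < (σ i : Bool → ℝ) (x i) := by
    refine (strategy_nonneg _ _).lt_of_ne fun h => hx.ne' ?_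
    rw [weight_eq_mul σ x i, ← h, zero_mul]
  have hs := strategy_sum (σ i)
  have h1 := strategy_le_one (σ i) true
  refine ⟨i, ?_⟩
  cases h : x i
  · rw [h] at hxi hi
    have : (σ i : Bool → ℝ) true = 1 := by simpa [rounding] using hi
    linarith
  · rw [h] at hxi hi
    have : (σ i : Bool → ℝ) true ≠ 1 := by simpa [rounding] using hi
    exact ⟨hxi, by linarith [lt_of_le_of_ne h1 this]⟩

end Equilibria

/-! ### Query transcripts. -/

namespace Algorithm

variable {n : ℕ}

/-- The pure profiles that the algorithm queries on the game `u`, in order. -/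
def queries (u : Game n) : Algorithm n → List (Profile n)
  | output _ => []
  | query a next => a :: queries u (next fun i => u i a)

theorem length_queries (u : Game n) (A : Algorithm n) :
    (A.queries u).length = A.numQueries u := by
  induction A with
  | output σ => rfl
  | query a next ih => simp [queries, numQueries, ih]

theorem run_congr {u u' : Game n} (A : Algorithm n)
    (h : ∀ a ∈ A.queries u, ∀ i, u i a = u' i a) : A.run u = A.run u' := by
  induction A with
  | output σ => rfl
  | query a next ih =>
    have ha : (fun i => u i a) = fun i => u' i a :=
      funext fun i => h a (by simp [queries]) i
    simp only [run, ← ha]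
    exact ih _ fun b hb => h b (by simp [queries, hb])

/-- Only the answers to earlier queries influence query number `s`; the value `none` covers runs
that have already stopped. -/
theorem getElem?_queries_congr {u u' : Game n} (A : Algorithm n) (s : ℕ)
    (h : ∀ r < s, ∀ a, (A.queries u)[r]? = some a → ∀ i, u i a = u' i a) :
    (A.queries u)[s]? = (A.queries u')[s]? := by
  induction A generalizing s with
  | output σ => rfl
  | query a next ih =>
    cases s with
    | zero => simp [queries]
    | succ s =>
      have ha : (fun i => u i a) = fun i => u' i a :=
        funext fun i => h 0 (Nat.succ_pos s) a (by simp [queries]) i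
      simp only [queries, List.getElem?_cons_succ, ← ha]
      exact ih _ s fun r hr b hb => h (r + 1) (by omega) b (by simpa [queries] using hb)

/-- The algorithm that moreover queries the rounding of its output. -/
noncomputable def queryOutput : Algorithm n → Algorithm n
  | output σ => query (rounding σ) fun _ => output σ
  | query a next => query a fun r => queryOutput (next r)

theorem run_queryOutput (u : Game n) (A : Algorithm n) : A.queryOutput.run u = A.run u := by
  induction A with
  | output σ => rfl
  | query a next ih => simp [queryOutput, run, ih]

theorem numQueries_queryOutput (u : Game n) (A : Algorithm n) :
    A.queryOutput.numQueries u = A.numQueries u + 1 := by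
  induction A with
  | output σ => rfl
  | query a next ih => simp [queryOutput, numQueries, ih]

theorem rounding_mem_queries (u : Game n) (A : Algorithm n) :
    rounding (A.run u) ∈ A.queryOutput.queries u := by
  induction A with
  | output σ => simp [queryOutput, queries, run]
  | query a next ih => simp [queryOutput, queries, run, ih]

end Algorithm

/-! ### The hidden path and its utility. -/

section HiddenPath

variable {n : ℕ}

/-- The lazy walk on the cube through the waypoints `v 0, v 1, …`, which are visited at the
multiples of `n`; in between the coordinates are updated one at a time. -/
def path (v : ℕ → Profile n) (t : ℕ) : Profile n := fun p => v ((t + p) / n) p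

/-- Coordinate `p` can change only when `n` divides `t + p + 1`, which singles out one `p` for each
`t`. -/
theorem path_succ (v : ℕ → Profile n) (t : ℕ) :
    path v (t + 1) = path v t ∨ ∃ i b, path v (t + 1) = Function.update (path v t) i b := by
  by_cases h : path v (t + 1) = path v t
  · exact Or.inl h
  obtain ⟨i, hi⟩ := Function.ne_iff.mp h
  have hdvd : ∀ p : Fin n, path v (t + 1) p ≠ path v t p → n ∣ t + p + 1 := fun p hp => by
    by_contra hnd
    refine hp ?_
    have : (t + 1 + p) / n = (t + p) / n := by
      rw [show t + 1 + (p : ℕ) = t + p + 1 by ring, Nat.succ_div, if_neg hnd, add_zero]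
    simp only [path, this]
  refine Or.inr ⟨i, path v (t + 1) i, ?_⟩
  funext p
  by_cases hpi : p = i
  · rw [hpi, Function.update_self]
  rw [Function.update_of_ne hpi]
  by_contra hp
  refine hpi (Fin.ext ?_)
  have h1 : (t + 1 + (p : ℕ)) ≡ t + 1 + i [MOD n] := by
    refine ((Nat.modEq_zero_iff_dvd.mpr ?_).trans (Nat.modEq_zero_iff_dvd.mpr ?_).symm)
    · convert hdvd p hp using 1; ring
    · convert hdvd i hi using 1; ring
  have h2 := Nat.ModEq.add_left_cancel' (t + 1) h1
  exact Nat.ModEq.eq_of_lt_of_lt h2 p.2 i.2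

theorem path_zero (v : ℕ → Profile n) : path v 0 = v 0 := by
  funext p
  simp [path, Nat.div_eq_of_lt p.2]

/-- A path vertex is ranked by the last time `t ≤ L` at which it is visited, the vertex at
time `L` with an additional bonus `s`; the other vertices have smaller ranks, which increase
towards the start of the path. -/
def rank (v : ℕ → Profile n) (L s : ℕ) (x : Profile n) : ℕ :=
  max (n - hammingDist x (v 0))
    (((range (L + 1)).filter fun t => path v t = x).sup fun t => n + t + if t = L then s else 0)

theorem le_rank_path (v : ℕ → Profile n) {L t : ℕ} (s : ℕ) (ht : t ≤ L) :
    (n + t + if t = L then s else 0) ≤ rank v L s (path v t) :=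
  le_max_of_le_right <| le_sup (f := fun t => n + t + if t = L then s else 0)
    (mem_filter.mpr ⟨mem_range.mpr (by omega), rfl⟩)

theorem rank_path_length (v : ℕ → Profile n) (L s : ℕ) :
    rank v L s (path v L) = n + L + s := by
  refine le_antisymm (max_le (by omega) (Finset.sup_le fun t ht => ?_)) ?_
  · have := mem_range.mp (mem_filter.mp ht).1
    split_ifs <;> omega
  · simpa using le_rank_path v s le_rfl

/-- From a path vertex, step along the path after its last visit; from any other vertex, correct one
coordinate towards the start. -/
theorem exists_rank_lt (v : ℕ → Profile n) {L s : ℕ} {x : Profile n} (hx : x ≠ path v L) :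
    ∃ i b, rank v L s x < rank v L s (Function.update x i b) := by
  by_cases hne : ((range (L + 1)).filter fun t => path v t = x).Nonempty
  · obtain ⟨t, ht, hsup⟩ := exists_mem_eq_sup _ hne
      fun t => n + t + if t = L then s else 0
    obtain ⟨htL, rfl⟩ := mem_filter.mp ht
    have htL' := mem_range.mp htL
    have hneL : t ≠ L := fun h => hx (by rw [h])
    have hrank : rank v L s (path v t) = n + t := by
      rw [rank, hsup, if_neg hneL]
      omega
    have hnext := le_rank_path v s (show t + 1 ≤ L by omega)
    rcases path_succ v t with h | ⟨i, b, h⟩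
    · rw [h, hrank] at hnext
      omega
    · refine ⟨i, b, ?_⟩
      rw [← h, hrank]
      omega
  · rw [not_nonempty_iff_eq_empty] at hne
    have hx0 : x ≠ v 0 := fun h => by
      have : (0 : ℕ) ∈ (range (L + 1)).filter fun t => path v t = x :=
        mem_filter.mpr ⟨by simp, by rw [path_zero, h]⟩
      rw [hne] at this
      exact absurd this (notMem_empty 0)
    obtain ⟨i, hi⟩ := Function.ne_iff.mp hx0
    refine ⟨i, v 0 i, ?_⟩
    have hlt : hammingDist (Function.update x i (v 0 i)) (v 0) < hammingDist x (v 0) := by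
      refine card_lt_card ⟨fun j hj => ?_, fun h => ?_⟩
      · simp only [mem_filter, mem_univ, true_and] at hj ⊢
        by_cases hji : j = i
        · rw [hji]; exact hi
        · rwa [Function.update_of_ne hji] at hj
      · have := h (mem_filter.mpr ⟨mem_univ i, hi⟩)
        simp at this
    have hle : hammingDist x (v 0) ≤ n := by
      simpa using hammingDist_le_card_fintype (x := x) (y := v 0)
    have h1 : rank v L s x = n - hammingDist x (v 0) := by
      rw [rank, hne]
      simp
    rw [h1]
    refine lt_max_of_lt_left ?_
    omega

/-- Off the part of the path after time `M`, the rank does not see that part. -/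
theorem rank_eq_of_forall_ne (v : ℕ → Profile n) {M L s s' : ℕ} (hML : M ≤ L) {x : Profile n}
    (hx : ∀ t, M ≤ t → t ≤ L → path v t ≠ x) : rank v L s x = rank v M s' x := by
  have hset : ((range (L + 1)).filter fun t => path v t = x)
      = (range (M + 1)).filter fun t => path v t = x := by
    ext t
    simp only [mem_filter, mem_range]
    constructor
    · rintro ⟨h1, h2⟩
      refine ⟨?_, h2⟩
      by_contra h
      exact hx t (by omega) (by omega) h2
    · rintro ⟨h1, h2⟩
      exact ⟨by omega, h2⟩
  rw [rank, rank, hset]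
  congr 1
  refine sup_congr rfl fun t ht => ?_
  obtain ⟨h1, h2⟩ := mem_filter.mp ht
  have h1 := mem_range.mp h1
  have htM : t ≠ M := fun h => hx t h.ge (by omega) h2
  rw [if_neg (by omega), if_neg htM]

theorem rank_congr {v w : ℕ → Profile n} {L : ℕ} (s : ℕ)
    (h : ∀ t ≤ L, path v t = path w t) : rank v L s = rank w L s := by
  funext x
  have h0 : v 0 = w 0 := by simpa [path_zero] using h 0 (Nat.zero_le L)
  rw [rank, rank, h0]
  congr 2
  refine filter_congr fun t ht => ?_
  rw [h t (by have := mem_range.mp ht; omega)]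

/-- The common utility whose logarithm is the rank. -/
def pathUtility (v : ℕ → Profile n) (L s : ℕ) (x : Profile n) : ℝ :=
  ((2 : ℝ) ^ (n + 1)) ^ rank v L s x

theorem weight_path_pos (v : ℕ → Profile n) {L s : ℕ} {σ : MixedProfile n}
    (hσ : IsNash (commonGame (pathUtility v L s)) σ) : 0 < weight σ (path v L) := by
  refine weight_pos_of_isNash (fun a => by unfold pathUtility; positivity) (fun a ha => ?_) hσ
  obtain ⟨i, b, h⟩ := exists_rank_lt v (s := s) ha
  refine ⟨i, b, ?_⟩
  rw [pathUtility, pathUtility, ← pow_succ']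
  exact pow_le_pow_right₀ (one_le_pow₀ (by norm_num)) h

/-- Without a query to the end of the path an algorithm cannot be right for both bonuses. -/
theorem not_isNash_and_isNash (v : ℕ → Profile n) (L : ℕ) (A : Algorithm n)
    (hA : path v L ∉ A.queryOutput.queries (commonGame (pathUtility v L 0))) :
    ¬ (IsNash (commonGame (pathUtility v L 0)) (A.run (commonGame (pathUtility v L 0))) ∧
      IsNash (commonGame (pathUtility v L 1)) (A.run (commonGame (pathUtility v L 1)))) := by
  rintro ⟨h0, h1⟩
  have hagree : ∀ a, a ≠ path v L → pathUtility v L 0 a = pathUtility v L 1 a := fun a ha => by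
    rw [pathUtility, pathUtility, rank_eq_of_forall_ne v le_rfl (s' := 1)]
    intro t h h' hta
    exact ha (by rw [← hta, le_antisymm h' h])
  have hrun : A.run (commonGame (pathUtility v L 0)) = A.run (commonGame (pathUtility v L 1)) := by
    rw [← A.run_queryOutput, ← A.run_queryOutput]
    exact Algorithm.run_congr _ fun a ha i => hagree a fun h => hA (h ▸ ha)
  rw [← hrun] at h1
  have hpos := weight_path_pos v h0
  obtain ⟨i, ht, hf⟩ := exists_mixing_of_rounding_ne hpos
    fun h => hA (h ▸ A.rounding_mem_queries _)
  have h := apply_eq_of_isNash_of_isNash hagree h0 h1 hpos ht hf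
  rw [pathUtility, pathUtility, rank_path_length, rank_path_length] at h
  have h2 : (1 : ℝ) < 2 ^ (n + 1) := one_lt_pow₀ (by norm_num) (by omega)
  have := pow_right_injective₀ (by positivity) h2.ne' h
  omega

/-- If no run on a path cut at a waypoint anticipates the path beyond the next waypoint, then
every query of the run on the whole path passes at most one new waypoint. -/
theorem getElem?_queries_ne_path (v : ℕ → Profile n) {m s : ℕ} (A : Algorithm n)
    (hA : ∀ i < m, ∀ t, (i + 1) * n ≤ t → t ≤ m * n → ∀ r : ℕ,
      (A.queries (commonGame (pathUtility v (i * n) 0)))[r]? ≠ some (path v t))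
    {r : ℕ} (hr : r < m) {t : ℕ} (ht : (r + 1) * n ≤ t) (htm : t ≤ m * n) :
    (A.queries (commonGame (pathUtility v (m * n) s)))[r]? ≠ some (path v t) := by
  induction r using Nat.strong_induction_on generalizing t with
  | _ r ih =>
    -- By induction the earlier queries miss the path from time `r * n` on, so their answers are
    -- those of the path cut there.
    rw [A.getElem?_queries_congr (u' := commonGame (pathUtility v (r * n) 0))]
    · exact hA r hr t ht htm r
    · intro k hk a ha i
      simp only [commonGame, pathUtility]
      rw [rank_eq_of_forall_ne v (Nat.mul_le_mul_right n hr.le) (s' := 0)]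
      intro t' h1 h2 h3
      rw [← h3] at ha
      exact ih k hk (hk.trans hr) ((Nat.mul_le_mul_right n hk).trans h1) h2 ha

end HiddenPath

/-! ### Counting the waypoints for which a query is a lucky guess. -/

section Counting

variable {n m : ℕ}

/-- The sequence of waypoints given by a finite family. -/
def waypoints (v : Fin (m + 1) → Profile n) (j : ℕ) : Profile n :=
  v ⟨min j m, by omega⟩

/-- Flip the coordinates in `d` of the vertex of the path at time `t`. -/
def shift (t : ℕ) (d : Profile n) (v : Fin (m + 1) → Profile n) : Fin (m + 1) → Profile n :=
  fun j p => if (j : ℕ) = (t + p) / n then xor (v j p) (d p) else v j p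

theorem shift_shift (t : ℕ) (d : Profile n) (v : Fin (m + 1) → Profile n) :
    shift t d (shift t d v) = v := by
  funext j p
  by_cases h : (j : ℕ) = (t + p) / n <;> simp [shift, h]

theorem path_waypoints_shift {t : ℕ} (ht : t ≤ m * n) (d : Profile n)
    (v : Fin (m + 1) → Profile n) :
    path (waypoints (shift t d v)) t = fun p => xor (path (waypoints v) t p) (d p) := by
  funext p
  have hle : (t + (p : ℕ)) / n ≤ m := by
    have hp := p.2
    rw [Nat.le_iff_lt_add_one, Nat.div_lt_iff_lt_mul (by omega), add_mul, one_mul]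
    omega
  simp [path, waypoints, shift, hle]

theorem path_waypoints_shift_of_le {i t t' : ℕ} (ht : (i + 1) * n ≤ t)
    (ht' : t' ≤ i * n) (d : Profile n) (v : Fin (m + 1) → Profile n) :
    path (waypoints (shift t d v)) t' = path (waypoints v) t' := by
  funext p
  have hp := p.2
  have h1 : (t' + (p : ℕ)) / n < i + 1 := by
    rw [Nat.div_lt_iff_lt_mul (by omega), add_mul, one_mul]
    omega
  have h2 : i + 1 ≤ (t + (p : ℕ)) / n := by
    rw [Nat.le_div_iff_mul_le (by omega)]
    omega
  have h3 : min ((t' + (p : ℕ)) / n) m ≠ (t + p) / n := by omega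
  simp [path, waypoints, shift, h3]

/-- Shifting by `d` preserves the path up to the cut, hence the guess, but translates the vertex at
time `t` by `d`. So `d`, and then `v`, can be recovered from the shifted waypoints. -/
theorem card_path_mem_mul_le {i t r : ℕ} (ht : (i + 1) * n ≤ t) (htm : t ≤ m * n)
    (A : Algorithm n) :
    #{v : Fin (m + 1) → Profile n |
        (A.queries (commonGame (pathUtility (waypoints v) (i * n) 0)))[r]?
          = some (path (waypoints v) t)} * 2 ^ n
      ≤ Fintype.card (Fin (m + 1) → Profile n) := by
  have hcard : 2 ^ n = #(univ : Finset (Profile n)) := by simp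
  rw [hcard, ← card_product, ← card_univ]
  have hinv : ∀ (d : Profile n) (v : Fin (m + 1) → Profile n),
      pathUtility (waypoints (shift t d v)) (i * n) 0 = pathUtility (waypoints v) (i * n) 0 := by
    intro d v
    funext x
    rw [pathUtility, pathUtility,
      rank_congr 0 fun t' ht' => path_waypoints_shift_of_le ht ht' d v]
  refine card_le_card_of_injOn (fun z => shift t z.2 z.1) (fun _ _ => mem_univ _) ?_
  rintro ⟨v, d⟩ hv ⟨w, e⟩ hw h
  simp only [coe_product, Set.mem_prod, mem_coe, mem_filter, mem_univ, true_and, and_true]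
    at hv hw h
  rw [← hinv d v, h, hinv e w, hw, Option.some.injEq] at hv
  have hde : d = e := by
    have h1 := path_waypoints_shift htm d v
    rw [h, path_waypoints_shift htm e w, hv] at h1
    funext p
    simpa using (congrFun h1 p).symm
  subst hde
  rw [← shift_shift t d v, h, shift_shift]

open Classical in
/-- The waypoints for which some run on a cut path anticipates the path. -/
noncomputable def anticipated (m : ℕ) (A : Algorithm n) : Finset (Fin (m + 1) → Profile n) :=
  {v | ∃ i < m, ∃ t, (i + 1) * n ≤ t ∧ t ≤ m * n ∧ ∃ r : ℕ,
      (A.queries (commonGame (pathUtility (waypoints v) (i * n) 0)))[r]?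
        = some (path (waypoints v) t)}

/-- A union bound over the cut `i`, the query number `r` and the time `t`. -/
theorem card_anticipated_mul_le (A : Algorithm n)
    (hA : ∀ φ : Profile n → ℝ, A.numQueries (commonGame φ) ≤ m) :
    #(anticipated m A) * 2 ^ n
      ≤ m * m * (m * n + 1) * Fintype.card (Fin (m + 1) → Profile n) := by
  classical
  let I : Finset (ℕ × ℕ × ℕ) := (range m ×ˢ range m ×ˢ range (m * n + 1)).filter
    fun z => (z.1 + 1) * n ≤ z.2.2
  have hsub : anticipated m A ⊆ I.biUnion fun z => {v : Fin (m + 1) → Profile n |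
        (A.queries (commonGame (pathUtility (waypoints v) (z.1 * n) 0)))[z.2.1]?
          = some (path (waypoints v) z.2.2)} := by
    intro v hv
    obtain ⟨i, hi, t, ht, htm, r, hr⟩ := (mem_filter.mp hv).2
    refine mem_biUnion.mpr ⟨(i, r, t), ?_, mem_filter.mpr ⟨mem_univ v, hr⟩⟩
    obtain ⟨hrl, -⟩ := List.getElem?_eq_some_iff.mp hr
    rw [Algorithm.length_queries] at hrl
    simp only [I, mem_filter, mem_product, mem_range]
    exact ⟨⟨hi, hrl.trans_le (hA _), by omega⟩, ht⟩
  have hI : #I ≤ m * m * (m * n + 1) := by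
    refine (card_filter_le _ _).trans (le_of_eq ?_)
    simp [mul_assoc]
  calc #(anticipated m A) * 2 ^ n
      ≤ (∑ z ∈ I, #{v : Fin (m + 1) → Profile n |
        (A.queries (commonGame (pathUtility (waypoints v) (z.1 * n) 0)))[z.2.1]?
          = some (path (waypoints v) z.2.2)}) * 2 ^ n :=
        Nat.mul_le_mul_right _ ((card_le_card hsub).trans card_biUnion_le)
    _ ≤ ∑ z ∈ I, Fintype.card (Fin (m + 1) → Profile n) := by
        rw [sum_mul]
        refine sum_le_sum fun z hz => ?_
        simp only [I, mem_filter, mem_product, mem_range] at hz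
        exact card_path_mem_mul_le hz.2 (by omega) A
    _ ≤ _ := by
        rw [sum_const, smul_eq_mul]
        exact Nat.mul_le_mul_right _ hI

/-- The hard games: the path through the given waypoints, with the given bonus at its end. -/
def hardGame (z : (Fin (m + 1) → Profile n) × Bool) : Game n :=
  commonGame (pathUtility (waypoints z.1) (m * n) z.2.toNat)

-- Waypoints that are not anticipated allow success for at most one of the two bonuses.
open Classical in
theorem card_isNash_le (A : Algorithm n)
    (hA : ∀ φ : Profile n → ℝ, A.queryOutput.numQueries (commonGame φ) ≤ m) :
    #{z : (Fin (m + 1) → Profile n) × Bool | IsNash (hardGame z) (A.run (hardGame z))}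
      ≤ Fintype.card (Fin (m + 1) → Profile n) + #(anticipated m A.queryOutput) := by
  have hnot : ∀ v ∉ anticipated m A.queryOutput,
      ¬ (IsNash (hardGame (v, false)) (A.run (hardGame (v, false))) ∧
        IsNash (hardGame (v, true)) (A.run (hardGame (v, true)))) := by
    intro v hv
    refine not_isNash_and_isNash (waypoints v) (m * n) A fun hmem => ?_
    obtain ⟨r, hr⟩ := List.mem_iff_getElem?.mp hmem
    obtain ⟨hrl, -⟩ := List.getElem?_eq_some_iff.mp hr
    rw [Algorithm.length_queries] at hrl
    have hrm := hrl.trans_le (hA _)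
    -- The end is visited at time `m * n ≥ (r + 1) * n`, out of reach for query number `r < m`.
    refine getElem?_queries_ne_path (waypoints v) A.queryOutput ?_ hrm
      (Nat.mul_le_mul_right n hrm) le_rfl hr
    intro i hi t ht htm k hk
    exact hv (mem_filter.mpr ⟨mem_univ v, i, hi, t, ht, htm, k, hk⟩)
  rw [card_filter, Fintype.sum_prod_type]
  calc ∑ v : Fin (m + 1) → Profile n, ∑ s : Bool,
        (if IsNash (hardGame (v, s)) (A.run (hardGame (v, s))) then 1 else 0)
      ≤ ∑ v : Fin (m + 1) → Profile n,
        (1 + if v ∈ anticipated m A.queryOutput then 1 else 0) := by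
        refine sum_le_sum fun v _ => ?_
        rw [Fintype.sum_bool]
        by_cases hv : v ∈ anticipated m A.queryOutput
        · rw [if_pos hv]
          split_ifs <;> omega
        · have := hnot v hv
          rw [if_neg hv]
          split_ifs <;> first | omega | tauto
    _ = _ := by
        rw [sum_add_distrib]
        simp

end Counting

/-! ### From deterministic to randomized algorithms, and the final estimate. -/

/-- Averaging: if all events have probability at least `a` and no point lies in more than `c`
of them, then there are at most `c / a` events. -/
theorem card_mul_le_of_forall_card_le {Ω ι : Type*} [Fintype ι] [MeasurableSpace Ω]
    (μ : MeasureTheory.Measure Ω) [MeasureTheory.IsProbabilityMeasure μ] {S : ι → Set Ω}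
    (hS : ∀ i, MeasurableSet (S i)) {a : ENNReal} (ha : ∀ i, a ≤ μ (S i)) {c : ℕ}
    (hc : ∀ ω, ∀ T : Finset ι, (∀ i ∈ T, ω ∈ S i) → #T ≤ c) :
    (Fintype.card ι : ENNReal) * a ≤ c := by
  classical
  calc (Fintype.card ι : ENNReal) * a = ∑ _i : ι, a := by simp
    _ ≤ ∑ i, μ (S i) := sum_le_sum fun i _ => ha i
    _ = ∑ i, ∫⁻ ω, (S i).indicator 1 ω ∂μ :=
        sum_congr rfl fun i _ => (MeasureTheory.lintegral_indicator_one (hS i)).symm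
    _ = ∫⁻ ω, ∑ i, (S i).indicator 1 ω ∂μ :=
        (MeasureTheory.lintegral_finsetSum _ fun i _ => measurable_one.indicator (hS i)).symm
    _ ≤ ∫⁻ _ω, (c : ENNReal) ∂μ := by
        refine MeasureTheory.lintegral_mono fun ω => ?_
        have h : ∑ i, (S i).indicator (1 : Ω → ENNReal) ω
            = (#(univ.filter fun i => ω ∈ S i) : ENNReal) := by
          rw [card_filter]
          push_cast
          exact sum_congr rfl fun i _ => by simp [Set.indicator_apply]
        simp only [h]
        exact_mod_cast hc ω _ fun i hi => (mem_filter.mp hi).2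
    _ = c := by simp

theorem two_pow_le_of_findsNash {n q : ℕ} (A : RandomizedAlgorithm n) (hq : A.QueriesAtMost q)
    (hA : A.FindsNash) : 2 ^ n ≤ 3 * ((q + 1) * (q + 1) * ((q + 1) * n + 1)) := by
  classical
  -- The extra query is that of the rounded output.
  set m := q + 1
  let V := Fin (m + 1) → Profile n
  choose S hmeas hprob hnash using fun z : V × Bool =>
    hA (hardGame z) (isPotentialGame_commonGame _)
  have hnum : ∀ ω, ∀ φ : Profile n → ℝ,
      (A.alg ω).queryOutput.numQueries (commonGame φ) ≤ m := fun ω φ => by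
    rw [Algorithm.numQueries_queryOutput]
    exact Nat.succ_le_succ (hq _ (isPotentialGame_commonGame φ) ω)
  by_contra! hlt
  have hVpos : 0 < Fintype.card V := Fintype.card_pos
  have hsmall : ∀ ω, 3 * #(anticipated m (A.alg ω).queryOutput) < Fintype.card V := fun ω => by
    have h := card_anticipated_mul_le (A.alg ω).queryOutput (hnum ω)
    by_contra! hle
    have h1 := Nat.mul_le_mul_right (2 ^ n) hle
    have h2 := Nat.mul_lt_mul_of_pos_left hlt hVpos
    nlinarith
  have hcount := card_mul_le_of_forall_card_le A.μ hmeas hprob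
    -- The largest integer strictly below `2/3` of the `2 * card V` hard games.
    (c := (4 * Fintype.card V - 1) / 3) fun ω T hT => by
      have h1 : #T ≤ #{z : V × Bool | IsNash (hardGame z) ((A.alg ω).run (hardGame z))} :=
        card_le_card fun z hz => mem_filter.mpr ⟨mem_univ z, hnash z ω (hT z hz)⟩
      have h2 := card_isNash_le (A.alg ω) (hnum ω)
      have h3 := hsmall ω
      have h4 : #T ≤ Fintype.card V + #(anticipated m (A.alg ω).queryOutput) := h1.trans h2
      omega
  rw [Fintype.card_prod, Fintype.card_bool] at hcount
  have hreal := ENNReal.toReal_mono (ENNReal.natCast_ne_top _) hcount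
  rw [ENNReal.toReal_mul, ENNReal.toReal_div, ENNReal.toReal_natCast, ENNReal.toReal_natCast]
    at hreal
  have hnat : 4 * Fintype.card V ≤ 3 * ((4 * Fintype.card V - 1) / 3) := by
    have : (4 * (Fintype.card V : ℝ)) ≤ 3 * (((4 * Fintype.card V - 1) / 3 : ℕ) : ℝ) := by
      push_cast [ENNReal.toReal_ofNat] at hreal
      linarith
    exact_mod_cast this
  omega

theorem three_mul_lt_two_pow {n q : ℕ} (hn : 24 ≤ n) (hq : (q : ℝ) < 2 ^ ((n : ℝ) / 8)) :
    3 * ((q + 1) * (q + 1) * ((q + 1) * n + 1)) < 2 ^ n := by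
  have hn' : (24 : ℝ) ≤ n := by exact_mod_cast hn
  set y : ℝ := 2 ^ ((n : ℝ) / 8) with hy
  have hy8 : y ^ 8 = 2 ^ n := by
    rw [hy, ← Real.rpow_natCast, ← Real.rpow_mul (by norm_num), ← Real.rpow_natCast]
    congr 1
    push_cast
    ring
  -- Bernoulli's inequality gives both `n ≤ 8 * y - 8` and, as `n ≥ 24`, `y ≥ 4`; the latter
  -- suffices for `192 * y^4 < y^8`.
  have hny : 1 + (n : ℝ) / 8 ≤ y := by
    have h := one_add_mul_self_le_rpow_one_add (s := 1) (by norm_num)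
      (show (1 : ℝ) ≤ (n : ℝ) / 8 by linarith)
    rw [mul_one, one_add_one_eq_two] at h
    exact h
  have hy4 : 4 ≤ y := by linarith
  have hq1 : (q : ℝ) + 1 ≤ 2 * y := by linarith
  have hqn : ((q : ℝ) + 1) * n + 1 ≤ 2 * y * (8 * y) := by
    have h : ((q : ℝ) + 1) * n ≤ 2 * y * (8 * y - 8) :=
      mul_le_mul hq1 (by linarith) (by linarith) (by linarith)
    linarith
  have hreal : 3 * (((q : ℝ) + 1) * (q + 1) * ((q + 1) * n + 1)) < 2 ^ n :=
    calc 3 * (((q : ℝ) + 1) * (q + 1) * ((q + 1) * n + 1))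
        ≤ 3 * (2 * y * (2 * y) * (2 * y * (8 * y))) := by gcongr
      _ = 192 * y ^ 4 := by ring
      _ < y ^ 4 * y ^ 4 := by
        have : (4 : ℝ) ^ 4 ≤ y ^ 4 := by gcongr
        exact mul_lt_mul_of_pos_right (by linarith) (by linarith)
      _ = 2 ^ n := by rw [← hy8]; ring
  exact_mod_cast hreal

end PotentialQuery

theorem corollary4p2 :
    ∃ c : ℝ, 0 < c ∧ ∃ N : ℕ, ∀ n : ℕ, N ≤ n →
      (⌈(2 : ℝ) ^ (c * Real.sqrt (n : ℝ))⌉₊ : ℕ∞) ≤ PotentialQuery.queryComplexity n := by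
  refine ⟨1 / 8, by norm_num, 24, fun n hn => le_iInf₂ fun q hq => ?_⟩
  obtain ⟨A, hAq, hA⟩ := hq
  rw [Nat.cast_le, Nat.ceil_le]
  by_contra! hlt
  have hsqrt : Real.sqrt n ≤ n := by
    have h1 : (1 : ℝ) ≤ n := by exact_mod_cast (show 1 ≤ n by omega)
    rw [Real.sqrt_le_left (by linarith)]
    nlinarith
  have hlt' : (q : ℝ) < 2 ^ ((n : ℝ) / 8) :=
    hlt.trans_le (Real.rpow_le_rpow_of_exponent_le (by norm_num) (by linarith))
  exact (PotentialQuery.three_mul_lt_two_pow hn hlt').not_ge (PotentialQuery.two_pow_le_of_findsNash A hAq hA)
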